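/- Let $n,m,d\ge 0$ be integers, let $N=\{0,1\}^n$, $M=\{0,1\}^m$, $D=\{0,1\}^d$, and let $\mathrm{Ext}=\{f_s\}_{s\in D}$ be a family of functions $f_s:N\to M$. Let $F_s:\mathbb{C}^N\to\mathbb{C}^M$ be the linear map with $(F_sP)(y)=\sum_{x:f_s(x)=y}P(x)$, let $\upsilon_M$ be the uniform distribution on $M$, and put $$\Delta[\mathrm{Ext}](P)=\frac1{|D|}\sum_{s\in D}F_s(P)-\Big(\sum_{x\in N}P(x)\Big)\upsilon_M .$$ For a positive integer $Q$, regard $x\in\mathrm{Mat}_Q(\mathbb{C}^N)$ as the block-diagonal matrix $\sum_{k\in N}x_k\otimes|k\rangle\langle k|\in\mathrm{Mat}_Q\otimes\mathrm{Mat}_N=\mathrm{Mat}_{QN}$. Write $\|\cdot\|_\infty,\|\cdot\|_1,\|\cdot\|_2$ for the operator norm, the trace norm and the Hilbert–Schmidt norm of matrices. For $K>0$ the operator space $\cap\cdot\cap\{K\ell_\infty,\ell_1\}$ on $\mathbb{C}^N$ is given by the norms $$\|x\|_{M_Q(\cap\cdot\cap\{K\ell_\infty,\ell_1\})}=\inf\Big\{\max\{\sqrt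 K\|a\|_\infty,\|\Gamma(a)\|_\infty\}\cdot\max\{\sqrt K\|b\|_\infty,\|\Gamma(b)\|_\infty\}:\ x=ab^*,\ a,b\in\mathrm{Mat}_{QN}\Big\},$$ where $\Gamma$ is the linear map with $\Gamma(|i\rangle\langle j|\otimes|k\rangle\langle l|)=|i\rangle\langle j|\otimes\langle k|\otimes\langle l|$. The operator space $\ell_1$ on $\mathbb{C}^M$ is given by $$\|y\|_{M_Q(\ell_1)}=\sup\{\|(A\otimes 1_M)\,y\,(B\otimes 1_M)\|_1:\ A,B\in\mathrm{Mat}_Q,\ \|A\|_2\le1,\ \|B\|_2\le 1\}.$$ The completely bounded norm of a linear map $u:E\to F$ is $\|u:E\to F\|_{\mathrm{cb}}=\sup_Q\sup\{\|(u(x_{ij}))_{ij}\|_{M_Q(F)}:\|x\|_{M_Q(E)}\le1\}$. A classical-quantum state $\rho_{QN}=\sum_{k\in N}\rho_k\otimes|k\rangle\langle k|$ is a positive semidefinite matrix of this form with trace one; $\rho_Q=\sum_k\rho_k$, and its conditional min-entropy is $$H_{\min}(N|Q)_\rho=-\log_2\min_\sigma\big\|(\sigma^{-1/2}\otimes1_N)\rho_{QN}(\sigma^{-1/2}\otimes1_N)\big\|_\infty,$$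 the minimum being over the density matrices $\sigma\in\mathrm{Mat}_Q$ whose support contains the support of $\rho_Q$, with generalized inverses. $\mathrm{Ext}$ is a quantum-proof $(k,\varepsilon)$-extractor if for every finite dimension $Q$ and every classical-quantum state $\rho_{QN}$ with $H_{\min}(N|Q)_\rho\ge k$, $$\Big\|\frac1{|D|}\sum_{s\in D}(\mathrm{id}_Q\otimes F_s)(\rho_{QN})-\rho_Q\otimes\upsilon_M\Big\|_1\le\varepsilon .$$ Then for all real $k$ and all $\varepsilon\ge0$: 1. if $\big\|\Delta[\mathrm{Ext}]:\cap\cdot\cap\{2^k\ell_\infty,\ell_1\}\to\ell_1\big\|_{\mathrm{cb}}\le\varepsilon$, then $\mathrm{Ext}$ is a quantum-proof $(k,2\varepsilon)$-extractor; 2. if $k\le n$ and $\mathrm{Ext}$ is a quantum-proof $(k-1,\varepsilon)$-extractor, then $\big\|\Delta[\mathrm{Ext}]:\cap\cdot\cap\{2^k\ell_\infty,\ell_1\}\to\ell_1\big\|_{\mathrm{cb}}\le8\varepsilon$. -/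

import Mathlib

open scoped ENNReal Kronecker

noncomputable section

namespace QuantumExtractor

/-! ### Norms of complex matrices -/

section Matrices

variable {m n : Type*} [Fintype m] [Fintype n] [DecidableEq m] [DecidableEq n]

open scoped Matrix.Norms.L2Operator in
/-- The operator norm (largest singular value) of a rectangular complex matrix. -/
def opNorm (A : Matrix m n ℂ) : ℝ := ‖A‖

open scoped MatrixOrder in
/-- The trace norm `Tr √(A* A)`. -/
def traceNorm (A : Matrix n n ℂ) : ℝ := (CFC.abs A).trace.re

/-- The Hilbert-Schmidt norm `√(Tr (A* A))`. -/
def hsNorm (A : Matrix n n ℂ) : ℝ := √((A.conjTranspose * A).trace.re)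

open scoped ComplexOrder in
/-- Density matrices: positive semidefinite matrices of trace one. -/
def IsState (σ : Matrix n n ℂ) : Prop := σ.PosSemidef ∧ σ.trace = 1

/-- `σ ^ (-1/2)` with the generalized inverse: the eigenvalue `t` is replaced by `1 / √t` if `t > 0`
and by `0` if `t = 0`. -/
def invSqrt (σ : Matrix n n ℂ) : Matrix n n ℂ := cfc (fun t : ℝ => (√t)⁻¹) σ

end Matrices

/-! ### Operator space structures and completely bounded norms -/

section OperatorSpaces

/-- A matrix norm structure on `E`: for every `q`, a size function on the `q × q` matrices with
entries in `E`. Values in `[0, ∞]` are used so that suprema and infima need no side conditions. -/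
abbrev MatrixNorms (E : Type*) := (q : ℕ) → Matrix (Fin q) (Fin q) E → ℝ≥0∞

/-- The completely bounded norm
`sup_q sup {‖(u (x i j))_{i j}‖_{M_q(F)} : ‖x‖_{M_q(E)} ≤ 1}`. -/
def cbNorm {E F : Type*} [AddCommGroup E] [Module ℂ E] [AddCommGroup F] [Module ℂ F]
    (normE : MatrixNorms E) (normF : MatrixNorms F) (u : E →ₗ[ℂ] F) : ℝ≥0∞ :=
  ⨆ (q : ℕ) (x : Matrix (Fin q) (Fin q) E) (_ : normE q x ≤ 1), normF q (x.map u)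

variable {q : ℕ} {N : Type*} [Fintype N] [DecidableEq N]

/-- The embedding of `Mat_q(ℂ^N)` into `Mat_{qN}` as block-diagonal matrices,
`x ↦ ∑ k, x_k ⊗ |k⟩⟨k|`. -/
def embed (x : Matrix (Fin q) (Fin q) (N → ℂ)) : Matrix (Fin q × N) (Fin q × N) ℂ :=
  Matrix.blockDiagonal fun k => x.map fun v => v k

/-- The reshuffling `Γ (|i⟩⟨j| ⊗ |k⟩⟨l|) = |i⟩⟨j| ⊗ ⟨k| ⊗ ⟨l|`, from `Mat_{qN}` to matrices with
row index `i` and column index `(j, k, l)`. -/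
def Gam (a : Matrix (Fin q × N) (Fin q × N) ℂ) : Matrix (Fin q) (Fin q × N × N) ℂ :=
  Matrix.of fun i c => a (i, c.2.1) (c.1, c.2.2)

/-- `max {√K ‖a‖, ‖Γ a‖}`, with operator norms. -/
def factorNorm (K : ℝ) (a : Matrix (Fin q × N) (Fin q × N) ℂ) : ℝ :=
  max (√K * opNorm a) (opNorm (Gam a))

/-- The operator space `∩·∩{K ℓ_∞, ℓ_1}` on `ℂ^N`: the norm of `x ∈ Mat_q(ℂ^N)` is the infimum of
`max {√K ‖a‖, ‖Γ a‖} * max {√K ‖b‖, ‖Γ b‖}` over all factorizations `x = a b*` in `Mat_{qN}`. -/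
def capCap (N : Type*) [Fintype N] [DecidableEq N] (K : ℝ) : MatrixNorms (N → ℂ) := fun q x =>
  ⨅ (a : Matrix (Fin q × N) (Fin q × N) ℂ) (b : Matrix (Fin q × N) (Fin q × N) ℂ)
    (_ : embed x = a * b.conjTranspose), ENNReal.ofReal (factorNorm K a * factorNorm K b)

/-- The operator space `ℓ_1` on `ℂ^N` (the diagonal of the trace class operator space): the norm of
`x ∈ Mat_q(ℂ^N)` is the supremum of the trace norms of `(A ⊗ 1) x (B ⊗ 1)` over `A, B ∈ Mat_q` of
Hilbert-Schmidt norm at most one. -/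
def ellOne (N : Type*) [Fintype N] [DecidableEq N] : MatrixNorms (N → ℂ) := fun q x =>
  ⨆ (A : Matrix (Fin q) (Fin q) ℂ) (B : Matrix (Fin q) (Fin q) ℂ)
    (_ : hsNorm A ≤ 1) (_ : hsNorm B ≤ 1),
    ENNReal.ofReal (traceNorm
      ((A ⊗ₖ (1 : Matrix N N ℂ)) * embed x * (B ⊗ₖ (1 : Matrix N N ℂ))))

end OperatorSpaces

/-! ### Classical-quantum states and conditional min-entropy -/

section States

variable {q : ℕ} {N : Type*} [Fintype N] [DecidableEq N]

/-- The partial trace over the classical system. -/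
def marginal (ρ : Matrix (Fin q) (Fin q) (N → ℂ)) : Matrix (Fin q) (Fin q) ℂ :=
  ρ.map fun v => ∑ k, v k

/-- `ρ = ∑ k, ρ_k ⊗ |k⟩⟨k|` is a classical-quantum density matrix. -/
def IsCQState (ρ : Matrix (Fin q) (Fin q) (N → ℂ)) : Prop := IsState (embed ρ)

/-- The conditional min-entropy
`H_min(N|Q) = - log₂ min_σ ‖(σ^{-1/2} ⊗ 1) ρ (σ^{-1/2} ⊗ 1)‖`, where `σ` runs over the states on `Q`
whose support contains that of `ρ_Q` (equivalently, whose kernel is contained in that of `ρ_Q`). -/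
def condMinEntropy (ρ : Matrix (Fin q) (Fin q) (N → ℂ)) : ℝ :=
  - Real.logb 2 (sInf {t : ℝ | ∃ σ : Matrix (Fin q) (Fin q) ℂ, IsState σ ∧
      (∀ v : Fin q → ℂ, σ.mulVec v = 0 → (marginal ρ).mulVec v = 0) ∧
      t = opNorm ((invSqrt σ ⊗ₖ (1 : Matrix N N ℂ)) * embed ρ *
        (invSqrt σ ⊗ₖ (1 : Matrix N N ℂ)))})

end States

/-! ### Extractors -/

section Extractors

variable {N M D : Type*} [Fintype N] [Fintype M] [Fintype D] [DecidableEq N] [DecidableEq M]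

/-- The linear map `F` on `ℂ^N` given by the `M × N` matrix with entry `1` at `(y, x)` if
`f x = y`, and `0` otherwise. -/
def pushMap (f : N → M) : (N → ℂ) →ₗ[ℂ] (M → ℂ) :=
  Matrix.toLin' (Matrix.of fun y x => if f x = y then 1 else 0)

/-- The uniform distribution. -/
def uniform (M : Type*) [Fintype M] : M → ℂ := fun _ => (Fintype.card M : ℂ)⁻¹

/-- `Δ[Ext] P = (1 / D) ∑ s, F_s P - (∑ x, P x) υ_M`. -/
def Delta (f : D → N → M) : (N → ℂ) →ₗ[ℂ] (M → ℂ) :=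
  (Fintype.card D : ℂ)⁻¹ • ∑ s, pushMap (f s) -
    (∑ x : N, LinearMap.proj x : (N → ℂ) →ₗ[ℂ] ℂ).smulRight (uniform M)

/-- The family `f` is a quantum-proof `(k, ε)`-extractor: for every finite-dimensional `Q` and every
classical-quantum state with `H_min(N|Q) ≥ k`,
`‖(1 / D) ∑ s, (id_Q ⊗ F_s) ρ - ρ_Q ⊗ υ_M‖₁ ≤ ε`. -/
def IsQuantumProof (k ε : ℝ) (f : D → N → M) : Prop :=
  ∀ (q : ℕ) (ρ : Matrix (Fin q) (Fin q) (N → ℂ)), IsCQState ρ → k ≤ condMinEntropy ρ →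
    traceNorm (embed ((Fintype.card D : ℂ)⁻¹ • ∑ s, ρ.map (pushMap (f s)) -
      (marginal ρ).map fun c => c • uniform M)) ≤ ε

end Extractors

end QuantumExtractor

end

set_option linter.unusedSectionVars false

noncomputable section

namespace QuantumExtractor

open scoped ENNReal Kronecker MatrixOrder ComplexOrder Matrix

/-! ### Polar decomposition and the trace norm. -/

section TraceNorm

variable {n : Type*} [Fintype n]

/-! Put `K = 2 ^ k`. Both norms of a factor `a` depend only on `a aᴴ`: `factorNorm K a ≤ 1` means `a
aᴴ ≤ K⁻¹` and `Tr_N (a aᴴ) ≤ 1`. Min-entropy at least `k` means, up to an arbitrarily small error,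
`ρ ≤ K⁻¹ σ₀ ⊗ 1` for a state `σ₀`. Conjugation by a square root of an operator on `Q` translates
between the two.

Norm to extractor: `σ = σ₀ + ρ_Q` (slightly perturbed) dominates both `K ρ` and the marginal, so `x
= σ^(-1/2) ρ σ^(-1/2)` factors as `√x √x` inside the unit ball. Testing the `ℓ_1` norm with `A = B =
σ^(1/2) / √(Tr σ)` recovers `ρ`, at the cost of `Tr σ ≈ 2` (`traceNorm_map_le_of_cbNorm_le`).

Extractor to norm: for `x = a bᴴ`, `(A ⊗ 1) x (B ⊗ 1) = α βᴴ` with `α = (A ⊗ 1) a` and `β = (Bᴴ ⊗ 1)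
b`. Polarization reduces this to four positive operators, whose diagonal parts have trace at most
about `4` and are dominated by `(4 / K) C ⊗ 1` with `Tr C ≤ 1`. Each is completed to a state by
adding a multiple of the flat state. Two terms bounded by `K⁻¹` cost one bit of entropy, and
subtracting the flat part again costs a factor `2` (`traceNorm_map_le_of_isQuantumProof`), whence `8
ε`. -/

theorem re_trace_le_re_trace {A B : Matrix n n ℂ} (h : A ≤ B) : A.trace.re ≤ B.trace.re := by
  have := (Complex.le_def.1 (Matrix.le_iff.1 h).trace_nonneg).1
  rw [Matrix.trace_sub, Complex.sub_re, Complex.zero_re] at this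
  linarith

variable [DecidableEq n]

theorem cfc_continuousOn (g : ℝ → ℝ) (A : Matrix n n ℂ) : ContinuousOn g (spectrum ℝ A) :=
  A.finite_real_spectrum.continuousOn g

/-- A positive semidefinite matrix pairs with contractions to at most its trace. -/
theorem re_trace_mul_le {C H : Matrix n n ℂ} (hC : Cᴴ * C ≤ 1) (hH : 0 ≤ H) :
    (C * H).trace.re ≤ H.trace.re := by
  -- Expanding gives `2 Re Tr (C H) ≤ Tr H + Tr (C H Cᴴ)`, and the last trace is at most `Tr H`.
  have h1 : 0 ≤ (1 - C) * H * (1 - C)ᴴ := star_right_conjugate_nonneg hH (1 - C)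
  have h2 := re_trace_le_re_trace h1
  obtain ⟨S, hS, hSH⟩ : ∃ S : Matrix n n ℂ, Sᴴ = S ∧ S * S = H :=
    ⟨CFC.sqrt H, (CFC.sqrt_nonneg H).isSelfAdjoint.star_eq, CFC.sqrt_mul_sqrt_self H⟩
  have h3 : (C * H * Cᴴ).trace.re ≤ H.trace.re := by
    have h4 := re_trace_le_re_trace (star_left_conjugate_le_conjugate hC S)
    simp only [Matrix.star_eq_conjTranspose, hS, mul_one, hSH] at h4
    convert h4 using 2
    rw [← hSH, Matrix.trace_mul_comm, ← mul_assoc, ← mul_assoc, Matrix.trace_mul_comm]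
    simp only [mul_assoc]
  have h5 : ((H * Cᴴ).trace).re = ((C * H).trace).re := by
    have : H * Cᴴ = (C * H)ᴴ := by
      rw [Matrix.conjTranspose_mul, ← hSH, Matrix.conjTranspose_mul, hS]
    rw [this, Matrix.trace_conjTranspose]; simp
  have h6 : (1 - C) * H * (1 - C)ᴴ = H - C * H - H * Cᴴ + C * H * Cᴴ := by
    rw [Matrix.conjTranspose_sub, Matrix.conjTranspose_one]; noncomm_ring
  rw [h6] at h2
  simp only [Matrix.trace_add, Matrix.trace_sub, Complex.add_re, Complex.sub_re, Matrix.trace_zero,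
    Complex.zero_re, h5] at h2
  linarith

theorem cfc_mul_cfc (g h : ℝ → ℝ) (A : Matrix n n ℂ) :
    cfc g A * cfc h A = cfc (fun t => g t * h t) A :=
  (cfc_mul g h A (cfc_continuousOn _ _) (cfc_continuousOn _ _)).symm

theorem cfc_conjTranspose (g : ℝ → ℝ) (A : Matrix n n ℂ) : (cfc g A)ᴴ = cfc g A :=
  (cfc_predicate g A : IsSelfAdjoint (cfc g A)).star_eq

theorem le_one_of_idempotent {P : Matrix n n ℂ} (h : Pᴴ = P) (hP : P * P = P) : P ≤ 1 := by
  have h1 : 0 ≤ (1 - P)ᴴ * (1 - P) := star_mul_self_nonneg (1 - P)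
  have h2 : (1 - P)ᴴ * (1 - P) = 1 - P := by
    rw [Matrix.conjTranspose_sub, h, Matrix.conjTranspose_one, sub_mul, mul_sub, mul_sub, hP]
    simp
  rw [h2] at h1
  exact sub_nonneg.1 h1

/-- The partial isometry of the polar decomposition. -/
theorem exists_polar (A : Matrix n n ℂ) : ∃ W : Matrix n n ℂ,
    Wᴴ * W ≤ 1 ∧ W * Wᴴ ≤ 1 ∧ W * A = CFC.abs A ∧ Wᴴ * CFC.abs A = A := by
  obtain ⟨H, hHdef⟩ : ∃ H, H = CFC.abs A := ⟨_, rfl⟩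
  have hH0 : 0 ≤ H := hHdef ▸ CFC.abs_nonneg A
  have hHsa : IsSelfAdjoint H := hH0.isSelfAdjoint
  have hHid : cfc (fun t : ℝ => t) H = H := cfc_id' ℝ H
  have hHH : Aᴴ * A = H * H := hHdef ▸ (CFC.abs_mul_abs A).symm
  rw [← hHdef]
  -- As `0⁻¹ = 0`, `G` is the pseudo-inverse of `|A|` and `P` below its support projection; the
  -- partial isometry is `G Aᴴ`.
  set G := cfc (fun t : ℝ => t⁻¹) H with hG
  have hGsa : Gᴴ = G := cfc_conjTranspose _ _
  set P := cfc (fun t : ℝ => t⁻¹ * t) H with hP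
  have hPsa : Pᴴ = P := cfc_conjTranspose _ _
  have hGH : G * H = P := by
    conv_lhs => rhs; rw [← hHid]
    exact cfc_mul_cfc _ _ _
  have hHG : H * G = P := by
    rw [← hHsa.star_eq, Matrix.star_eq_conjTranspose, ← hGsa, ← Matrix.conjTranspose_mul, hGH, hPsa]
  have hPP : P * P = P := by
    rw [hP, cfc_mul_cfc]
    congr 1; ext t
    by_cases ht : t = 0 <;> simp [ht]
  have hPH : P * H = H := by
    conv_lhs => rhs; rw [← hHid]
    rw [hP, cfc_mul_cfc]
    conv_rhs => rw [← hHid]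
    congr 1; ext t
    by_cases ht : t = 0 <;> simp [ht]
  have hPG : P * G = G := by
    rw [hP, hG, cfc_mul_cfc]
    congr 1; ext t
    by_cases ht : t = 0 <;> simp [ht]
  have hAP : A * P = A := by
    have : (A - A * P)ᴴ * (A - A * P) = 0 := by
      have : (A - A * P)ᴴ * (A - A * P) = (1 - P) * (Aᴴ * A) * (1 - P) := by
        rw [Matrix.conjTranspose_sub, Matrix.conjTranspose_mul, hPsa]; noncomm_ring
      rw [this, hHH, sub_mul, ← mul_assoc P, hPH]; simp
    exact (sub_eq_zero.1 (Matrix.conjTranspose_mul_self_eq_zero.1 this)).symm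
  refine ⟨G * Aᴴ, ?_, ?_, ?_, ?_⟩
  · rw [Matrix.conjTranspose_mul, Matrix.conjTranspose_conjTranspose, hGsa]
    refine le_one_of_idempotent ?_ ?_
    · simp only [Matrix.conjTranspose_mul, Matrix.conjTranspose_conjTranspose, hGsa, mul_assoc]
    · calc A * G * (G * Aᴴ) * (A * G * (G * Aᴴ))
          = A * G * (G * (Aᴴ * A) * G) * (G * Aᴴ) := by simp only [mul_assoc]
        _ = A * G * (P * (P * G)) * Aᴴ := by
          rw [hHH, ← mul_assoc G H H, hGH, mul_assoc P, hHG]; simp only [mul_assoc]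
        _ = A * G * (G * Aᴴ) := by rw [hPG, hPG]; simp only [mul_assoc]
  · rw [Matrix.conjTranspose_mul, Matrix.conjTranspose_conjTranspose, hGsa]
    have : G * Aᴴ * (A * G) = G * (Aᴴ * A) * G := by simp only [mul_assoc]
    rw [this, hHH, ← mul_assoc, hGH, mul_assoc, hHG, hPP]
    exact le_one_of_idempotent hPsa hPP
  · rw [mul_assoc, hHH, ← mul_assoc, hGH, hPH]
  · rw [Matrix.conjTranspose_mul, Matrix.conjTranspose_conjTranspose, hGsa, mul_assoc, hGH, hAP]

/-- In the polar form `A = Wᴴ |A|`, the product `C Wᴴ` is again a contraction. As the polar factor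
attains the bound, the triangle inequality follows. -/
theorem re_trace_mul_le_traceNorm {C : Matrix n n ℂ} (hC : Cᴴ * C ≤ 1) (A : Matrix n n ℂ) :
    (C * A).trace.re ≤ traceNorm A := by
  obtain ⟨W, -, hW, -, hA⟩ := exists_polar A
  conv_lhs => rw [← hA, ← mul_assoc]
  refine re_trace_mul_le ?_ (CFC.abs_nonneg A)
  rw [Matrix.conjTranspose_mul, Matrix.conjTranspose_conjTranspose]
  calc W * Cᴴ * (C * Wᴴ) = W * (Cᴴ * C) * Wᴴ := by simp only [mul_assoc]
    _ ≤ W * 1 * Wᴴ := star_right_conjugate_le_conjugate hC W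
    _ ≤ 1 := by rwa [mul_one]

theorem traceNorm_add_le (A B : Matrix n n ℂ) :
    traceNorm (A + B) ≤ traceNorm A + traceNorm B := by
  obtain ⟨W, hW, -, hWA, -⟩ := exists_polar (A + B)
  have h : traceNorm (A + B) = (W * A).trace.re + (W * B).trace.re := by
    rw [traceNorm, ← hWA, mul_add, Matrix.trace_add, Complex.add_re]
  rw [h]
  exact add_le_add (re_trace_mul_le_traceNorm hW A) (re_trace_mul_le_traceNorm hW B)

theorem traceNorm_smul (c : ℂ) (A : Matrix n n ℂ) : traceNorm (c • A) = ‖c‖ * traceNorm A := by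
  rw [traceNorm, CFC.abs_smul, Matrix.trace_smul]
  simp [traceNorm]

theorem traceNorm_zero : traceNorm (0 : Matrix n n ℂ) = 0 := by
  simp [traceNorm]

end TraceNorm

/-! ### Operator norm bounds as inequalities in the Loewner order. -/

section OpNorm

variable {m n : Type*} [Fintype m] [Fintype n] [DecidableEq m] [DecidableEq n]

theorem opNorm_nonneg (A : Matrix m n ℂ) : 0 ≤ opNorm A := by
  unfold opNorm
  open scoped Matrix.Norms.L2Operator in exact norm_nonneg A

theorem opNorm_le_iff {H : Matrix n n ℂ} (hH : 0 ≤ H) {r : ℝ} (hr : 0 ≤ r) :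
    opNorm H ≤ r ↔ H ≤ r • (1 : Matrix n n ℂ) := by
  unfold opNorm
  open scoped Matrix.Norms.L2Operator in
  rw [CStarAlgebra.norm_le_iff_le_algebraMap H hr hH, Algebra.algebraMap_eq_smul_one]

theorem opNorm_mul_conjTranspose_self (A : Matrix m n ℂ) : opNorm (A * Aᴴ) = opNorm A ^ 2 := by
  unfold opNorm
  open scoped Matrix.Norms.L2Operator in
  have h := Matrix.l2_opNorm_conjTranspose_mul_self Aᴴ
  rwa [Matrix.conjTranspose_conjTranspose, Matrix.l2_opNorm_conjTranspose, ← sq] at h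

theorem opNorm_le_iff_mul_conjTranspose {A : Matrix m n ℂ} {r : ℝ} (hr : 0 ≤ r) :
    opNorm A ≤ r ↔ A * Aᴴ ≤ (r ^ 2) • (1 : Matrix m m ℂ) := by
  rw [← opNorm_le_iff (Matrix.nonneg_iff_posSemidef.2 (Matrix.posSemidef_self_mul_conjTranspose A))
    (sq_nonneg r), opNorm_mul_conjTranspose_self, sq_le_sq₀ (opNorm_nonneg A) hr]

theorem opNorm_smul (c : ℝ) (A : Matrix m n ℂ) : opNorm (c • A) = |c| * opNorm A := by
  unfold opNorm
  open scoped Matrix.Norms.L2Operator in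
  exact norm_smul c A

theorem opNorm_eq_zero {A : Matrix m n ℂ} : opNorm A = 0 ↔ A = 0 := by
  unfold opNorm
  open scoped Matrix.Norms.L2Operator in
  exact norm_eq_zero

end OpNorm

/-! ### Block-diagonal matrices, partial traces and pinching. -/

section Blocks

variable {q : ℕ} {N M : Type*} [Fintype N] [DecidableEq N] [Fintype M] [DecidableEq M]

/-- The diagonal blocks of a matrix in `Mat_{qN}`. -/
def diagPart (Y : Matrix (Fin q × N) (Fin q × N) ℂ) : Matrix (Fin q) (Fin q) (N → ℂ) :=
  Matrix.of fun i j k => Y (i, k) (j, k)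

/-- Two-sided multiplication of every block by scalar matrices. -/
def sandwich (A : Matrix (Fin q) (Fin q) ℂ) (x : Matrix (Fin q) (Fin q) (N → ℂ))
    (B : Matrix (Fin q) (Fin q) ℂ) : Matrix (Fin q) (Fin q) (N → ℂ) :=
  Matrix.of fun i j k => (A * (x.map fun v => v k) * B) i j

theorem embed_apply (x : Matrix (Fin q) (Fin q) (N → ℂ)) (i j : Fin q) (k l : N) :
    embed x (i, k) (j, l) = if k = l then x i j k else 0 := rfl

theorem embed_add (x y : Matrix (Fin q) (Fin q) (N → ℂ)) :
    embed (x + y) = embed x + embed y := by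
  ext ⟨i, k⟩ ⟨j, l⟩
  simp only [Matrix.add_apply, embed_apply]; split_ifs <;> simp

theorem embed_smul {R : Type*} [Monoid R] [DistribMulAction R ℂ] (c : R)
    (x : Matrix (Fin q) (Fin q) (N → ℂ)) :
    embed (c • x) = c • embed x := by
  ext ⟨i, k⟩ ⟨j, l⟩
  simp only [Matrix.smul_apply, embed_apply]; split_ifs <;> simp

theorem diagPart_embed (x : Matrix (Fin q) (Fin q) (N → ℂ)) : diagPart (embed x) = x := by
  ext i j k
  simp [diagPart, embed_apply]

theorem embed_sandwich (A B : Matrix (Fin q) (Fin q) ℂ) (x : Matrix (Fin q) (Fin q) (N → ℂ)) :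
    embed (sandwich A x B) = (A ⊗ₖ (1 : Matrix N N ℂ)) * embed x * (B ⊗ₖ (1 : Matrix N N ℂ)) := by
  have h (C : Matrix (Fin q) (Fin q) ℂ) :
      C ⊗ₖ (1 : Matrix N N ℂ) = Matrix.blockDiagonal fun _ => C := by
    rw [Matrix.kronecker_one]
  rw [h, h, embed, embed, ← Matrix.blockDiagonal_mul, ← Matrix.blockDiagonal_mul]
  rfl

theorem diagPart_kronecker_mul_mul (A B : Matrix (Fin q) (Fin q) ℂ)
    (Y : Matrix (Fin q × N) (Fin q × N) ℂ) :
    diagPart ((A ⊗ₖ (1 : Matrix N N ℂ)) * Y * (B ⊗ₖ (1 : Matrix N N ℂ))) =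
      sandwich A (diagPart Y) B := by
  ext i j k
  simp [diagPart, sandwich, Matrix.mul_apply, Fintype.sum_prod_type, Matrix.one_apply,
    Finset.sum_mul]

/-- The map `u` acts on the classical index and the scalar matrices on the quantum one, so they
commute. -/
theorem sandwich_map (A B : Matrix (Fin q) (Fin q) ℂ) (x : Matrix (Fin q) (Fin q) (N → ℂ))
    (u : (N → ℂ) →ₗ[ℂ] (M → ℂ)) : (sandwich A x B).map u = sandwich A (x.map u) B := by
  ext i j y
  have h : sandwich A x B i j = ∑ l, ∑ l', (A i l' * B l j) • x l' l := by
    ext k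
    simp only [sandwich, Matrix.of_apply, Matrix.mul_apply, Matrix.map_apply, Finset.sum_apply,
      Pi.smul_apply, smul_eq_mul, Finset.sum_mul]
    exact Finset.sum_congr rfl fun l _ => Finset.sum_congr rfl fun l' _ => by ring
  rw [Matrix.map_apply, h]
  simp only [sandwich, map_sum, map_smul, Matrix.of_apply, Matrix.mul_apply, Matrix.map_apply,
    Finset.sum_apply, Pi.smul_apply, smul_eq_mul, Finset.sum_mul]
  exact Finset.sum_congr rfl fun l _ => Finset.sum_congr rfl fun l' _ => by ring

theorem marginal_sandwich (A B : Matrix (Fin q) (Fin q) ℂ) (x : Matrix (Fin q) (Fin q) (N → ℂ)) :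
    marginal (sandwich A x B) = A * marginal x * B := by
  have h : marginal x = ∑ k, x.map fun v => v k := by
    ext i j; simp [marginal, Matrix.sum_apply]
  rw [h, Finset.mul_sum, Finset.sum_mul]
  ext i j
  simp [marginal, sandwich, Matrix.sum_apply]

theorem trace_marginal_diagPart (Y : Matrix (Fin q × N) (Fin q × N) ℂ) :
    (marginal (diagPart Y)).trace = Y.trace := by
  simp [marginal, diagPart, Matrix.trace, Fintype.sum_prod_type]

theorem trace_embed (x : Matrix (Fin q) (Fin q) (N → ℂ)) :
    (embed x).trace = (marginal x).trace := by
  rw [← trace_marginal_diagPart, diagPart_embed]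

/-- This identifies `‖Γ a‖²` with the norm of the partial trace of `a aᴴ`. -/
theorem Gam_mul_conjTranspose_self (a : Matrix (Fin q × N) (Fin q × N) ℂ) :
    Gam a * (Gam a)ᴴ = marginal (diagPart (a * aᴴ)) := by
  ext i j
  simp only [Gam, marginal, diagPart, Matrix.mul_apply, Matrix.conjTranspose_apply, Matrix.of_apply,
    Matrix.map_apply, Fintype.sum_prod_type]
  rw [Finset.sum_comm]

theorem kronecker_one_nonneg {C : Matrix (Fin q) (Fin q) ℂ} (hC : 0 ≤ C) :
    0 ≤ C ⊗ₖ (1 : Matrix N N ℂ) :=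
  Matrix.nonneg_iff_posSemidef.2 <|
    (Matrix.nonneg_iff_posSemidef.1 hC).kronecker Matrix.PosSemidef.one

theorem sub_kronecker_one (E C : Matrix (Fin q) (Fin q) ℂ) :
    (E - C) ⊗ₖ (1 : Matrix N N ℂ) = E ⊗ₖ (1 : Matrix N N ℂ) - C ⊗ₖ (1 : Matrix N N ℂ) := by
  ext ⟨i, k⟩ ⟨j, l⟩; simp [sub_mul]

theorem kronecker_one_mono {C E : Matrix (Fin q) (Fin q) ℂ} (h : C ≤ E) :
    C ⊗ₖ (1 : Matrix N N ℂ) ≤ E ⊗ₖ (1 : Matrix N N ℂ) := by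
  have h1 : 0 ≤ (E - C) ⊗ₖ (1 : Matrix N N ℂ) := kronecker_one_nonneg (sub_nonneg.2 h)
  rw [sub_kronecker_one] at h1
  exact sub_nonneg.1 h1

theorem kronecker_one_mul (C E : Matrix (Fin q) (Fin q) ℂ) :
    (C ⊗ₖ (1 : Matrix N N ℂ)) * (E ⊗ₖ (1 : Matrix N N ℂ)) = (C * E) ⊗ₖ (1 : Matrix N N ℂ) := by
  rw [← Matrix.mul_kronecker_mul, one_mul]

theorem kronecker_one_conjTranspose (C : Matrix (Fin q) (Fin q) ℂ) :
    (C ⊗ₖ (1 : Matrix N N ℂ))ᴴ = Cᴴ ⊗ₖ (1 : Matrix N N ℂ) := by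
  rw [Matrix.conjTranspose_kronecker, Matrix.conjTranspose_one]

theorem marginal_diagPart_nonneg {Y : Matrix (Fin q × N) (Fin q × N) ℂ} (hY : 0 ≤ Y) :
    0 ≤ marginal (diagPart Y) := by
  have h : marginal (diagPart Y) = ∑ k, Y.submatrix (fun i => (i, k)) (fun i => (i, k)) := by
    ext i j; simp [marginal, diagPart, Matrix.sum_apply]
  rw [h]
  exact Finset.sum_nonneg fun k _ => Matrix.nonneg_iff_posSemidef.2
    ((Matrix.nonneg_iff_posSemidef.1 hY).submatrix _)

/-- Pinching is the Schur product with `J ⊗ 1`, `J` the all-ones matrix, so the Schur product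
theorem applies. -/
theorem embed_diagPart_nonneg {Y : Matrix (Fin q × N) (Fin q × N) ℂ} (hY : 0 ≤ Y) :
    0 ≤ embed (diagPart Y) := by
  have h : embed (diagPart Y) =
      ((Matrix.vecMulVec 1 (star 1) : Matrix (Fin q) (Fin q) ℂ) ⊗ₖ (1 : Matrix N N ℂ)).hadamard Y := by
    ext ⟨i, k⟩ ⟨j, l⟩
    by_cases h : k = l <;> simp [embed_apply, diagPart, h]
  rw [h, Matrix.nonneg_iff_posSemidef]
  exact ((Matrix.posSemidef_vecMulVec_self_star 1).kronecker Matrix.PosSemidef.one).hadamard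
    (Matrix.nonneg_iff_posSemidef.1 hY)

theorem embed_diagPart_sub (Y Z : Matrix (Fin q × N) (Fin q × N) ℂ) :
    embed (diagPart (Y - Z)) = embed (diagPart Y) - embed (diagPart Z) := by
  ext ⟨i, k⟩ ⟨j, l⟩
  simp only [Matrix.sub_apply, embed_apply, diagPart, Matrix.of_apply]; split_ifs <;> simp

theorem embed_diagPart_mono {Y Z : Matrix (Fin q × N) (Fin q × N) ℂ} (h : Y ≤ Z) :
    embed (diagPart Y) ≤ embed (diagPart Z) := by
  rw [← sub_nonneg, ← embed_diagPart_sub]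
  exact embed_diagPart_nonneg (sub_nonneg.2 h)

theorem embed_diagPart_kronecker_one (C : Matrix (Fin q) (Fin q) ℂ) :
    embed (diagPart (C ⊗ₖ (1 : Matrix N N ℂ))) = C ⊗ₖ (1 : Matrix N N ℂ) := by
  ext ⟨i, k⟩ ⟨j, l⟩
  by_cases h : k = l <;> simp [embed_apply, diagPart, h]

end Blocks

/-! ### Conditional min-entropy as domination by `σ ⊗ 1`. -/

section MinEntropy

variable {q : ℕ} {N : Type*} [Fintype N] [DecidableEq N]

theorem real_smul_nonneg {n : Type*} [Fintype n] [DecidableEq n] {r : ℝ} (hr : 0 ≤ r)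
    {H : Matrix n n ℂ} (hH : 0 ≤ H) : 0 ≤ r • H :=
  smul_nonneg hr hH

theorem real_smul_le {n : Type*} [Fintype n] [DecidableEq n] {r s : ℝ} (hr : r ≤ s)
    {H : Matrix n n ℂ} (hH : 0 ≤ H) : r • H ≤ s • H :=
  smul_le_smul_of_nonneg_right hr hH

/-- The square root of a positive semidefinite matrix and the projection onto its support. -/
theorem exists_sqrt_mul_invSqrt {n : Type*} [Fintype n] [DecidableEq n] {σ : Matrix n n ℂ}
    (hσ : 0 ≤ σ) : ∃ S P : Matrix n n ℂ, Sᴴ = S ∧ S * S = σ ∧ S * invSqrt σ = P ∧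
      invSqrt σ * S = P ∧ Pᴴ = P ∧ σ * P = σ := by
  have hsa : IsSelfAdjoint σ := hσ.isSelfAdjoint
  have hid : cfc (fun t : ℝ => t) σ = σ := cfc_id' ℝ σ
  refine ⟨cfc (fun t : ℝ => √t) σ, cfc (fun t : ℝ => √t * (√t)⁻¹) σ, cfc_conjTranspose _ _, ?_,
    cfc_mul_cfc _ _ _, ?_, cfc_conjTranspose _ _, ?_⟩
  · rw [cfc_mul_cfc]
    conv_rhs => rw [← hid]
    exact cfc_congr fun t ht => Real.mul_self_sqrt (spectrum_nonneg_of_nonneg hσ ht)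
  · rw [invSqrt, cfc_mul_cfc]
    simp only [mul_comm]
  · conv_lhs => lhs; rw [← hid]
    rw [cfc_mul_cfc]
    conv_rhs => rw [← hid]
    refine cfc_congr fun t ht => ?_
    have h0 : 0 ≤ t := spectrum_nonneg_of_nonneg hσ ht
    rcases h0.eq_or_lt with rfl | h
    · simp
    · have : √t ≠ 0 := (Real.sqrt_pos.2 h).ne'
      simp [this]

theorem exists_sqrt_mul_invSqrt_of_posDef {n : Type*} [Fintype n] [DecidableEq n]
    {σ : Matrix n n ℂ} (hσ : σ.PosDef) : ∃ S : Matrix n n ℂ, Sᴴ = S ∧ S * S = σ ∧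
      S * invSqrt σ = 1 ∧ invSqrt σ * S = 1 := by
  obtain ⟨S, P, h1, h2, h3, h4, -, h6⟩ :=
    exists_sqrt_mul_invSqrt (Matrix.nonneg_iff_posSemidef.2 hσ.posSemidef)
  have hP : P = 1 := hσ.isUnit.mul_left_cancel (by rw [h6, mul_one])
  exact ⟨S, h1, h2, hP ▸ h3, hP ▸ h4⟩

theorem invSqrt_conjTranspose {n : Type*} [Fintype n] [DecidableEq n] (σ : Matrix n n ℂ) :
    (invSqrt σ)ᴴ = invSqrt σ := cfc_conjTranspose _ _

theorem invSqrt_mul_mul_invSqrt {n : Type*} [Fintype n] [DecidableEq n] {σ : Matrix n n ℂ}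
    (hσ : σ.PosDef) : invSqrt σ * σ * invSqrt σ = 1 := by
  obtain ⟨S, -, hSS, hSI, hIS⟩ := exists_sqrt_mul_invSqrt_of_posDef hσ
  calc invSqrt σ * σ * invSqrt σ = (invSqrt σ * S) * (S * invSqrt σ) := by
        nth_rw 2 [← hSS]; simp only [mul_assoc]
    _ = 1 := by rw [hIS, hSI, one_mul]

/-- Conjugation by `σ ^ (-1/2)` turns a bound by `t σ ⊗ 1` into an operator norm bound. -/
theorem opNorm_invSqrt_le {ρ : Matrix (Fin q) (Fin q) (N → ℂ)} (hρ : 0 ≤ embed ρ)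
    {σ : Matrix (Fin q) (Fin q) ℂ} (hσ : σ.PosDef) {t : ℝ} (ht : 0 ≤ t)
    (h : embed ρ ≤ t • (σ ⊗ₖ (1 : Matrix N N ℂ))) :
    0 ≤ (invSqrt σ ⊗ₖ (1 : Matrix N N ℂ)) * embed ρ * (invSqrt σ ⊗ₖ (1 : Matrix N N ℂ)) ∧
    opNorm ((invSqrt σ ⊗ₖ (1 : Matrix N N ℂ)) * embed ρ *
        (invSqrt σ ⊗ₖ (1 : Matrix N N ℂ))) ≤ t := by
  have hstar : star (invSqrt σ ⊗ₖ (1 : Matrix N N ℂ)) = invSqrt σ ⊗ₖ (1 : Matrix N N ℂ) := by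
    rw [Matrix.star_eq_conjTranspose, kronecker_one_conjTranspose, invSqrt_conjTranspose]
  have h0 := star_left_conjugate_nonneg hρ (invSqrt σ ⊗ₖ (1 : Matrix N N ℂ))
  rw [hstar] at h0
  refine ⟨h0, (opNorm_le_iff h0 ht).2 ?_⟩
  have h1 := star_left_conjugate_le_conjugate h (invSqrt σ ⊗ₖ (1 : Matrix N N ℂ))
  rw [hstar, mul_smul_comm, smul_mul_assoc, kronecker_one_mul, kronecker_one_mul,
    invSqrt_mul_mul_invSqrt hσ, Matrix.one_kronecker_one] at h1
  exact h1

/-- Conversely, an operator norm bound after conjugation by `σ ^ (-1/2)` gives a bound by `t σ ⊗ 1`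
if the support of `σ` contains that of the marginal. -/
theorem embed_le_of_opNorm_invSqrt_le {ρ : Matrix (Fin q) (Fin q) (N → ℂ)} (hρ : 0 ≤ embed ρ)
    {σ : Matrix (Fin q) (Fin q) ℂ} (hσ : 0 ≤ σ)
    (hker : ∀ v : Fin q → ℂ, σ.mulVec v = 0 → (marginal ρ).mulVec v = 0) {t : ℝ} (ht0 : 0 ≤ t)
    (ht : opNorm ((invSqrt σ ⊗ₖ (1 : Matrix N N ℂ)) * embed ρ *
        (invSqrt σ ⊗ₖ (1 : Matrix N N ℂ))) ≤ t) :
    embed ρ ≤ t • (σ ⊗ₖ (1 : Matrix N N ℂ)) := by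
  obtain ⟨S, P, hS, hSS, hSI, hIS, hP, hσP⟩ := exists_sqrt_mul_invSqrt hσ
  have hstar : star (invSqrt σ ⊗ₖ (1 : Matrix N N ℂ)) = invSqrt σ ⊗ₖ (1 : Matrix N N ℂ) := by
    rw [Matrix.star_eq_conjTranspose, kronecker_one_conjTranspose, invSqrt_conjTranspose]
  -- The columns of `1 - P` lie in the kernel of `σ`, hence in that of the marginal.
  have hmarg : marginal ρ * (1 - P) = 0 := by
    refine Matrix.ext_of_mulVec_single fun i => ?_
    rw [← Matrix.mulVec_mulVec, Matrix.zero_mulVec]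
    apply hker
    rw [Matrix.mulVec_mulVec, mul_sub, hσP, mul_one, sub_self, Matrix.zero_mulVec]
  obtain ⟨R, hR, hRR⟩ : ∃ R, Rᴴ = R ∧ R * R = embed ρ :=
    ⟨CFC.sqrt (embed ρ), (CFC.sqrt_nonneg (embed ρ)).isSelfAdjoint.star_eq,
      CFC.sqrt_mul_sqrt_self (embed ρ)⟩
  set E := (1 - P) ⊗ₖ (1 : Matrix N N ℂ) with hE
  have hEE : Eᴴ = E := by
    rw [hE, kronecker_one_conjTranspose, Matrix.conjTranspose_sub, Matrix.conjTranspose_one, hP]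
  -- The trace of `(R E)ᴴ (R E)` is that of `(1 - P) ρ_Q (1 - P)`: the support of the marginal
  -- controls that of `ρ`.
  have hRE : R * E = 0 := by
    rw [← Matrix.trace_conjTranspose_mul_self_eq_zero_iff, Matrix.conjTranspose_mul, hR, hEE,
      mul_assoc, ← mul_assoc R, hRR, ← mul_assoc, hE, ← embed_sandwich, trace_embed,
      marginal_sandwich, mul_assoc, hmarg, mul_zero, Matrix.trace_zero]
  have hρE : embed ρ * E = 0 := by rw [← hRR, mul_assoc, hRE, mul_zero]
  have hE1 : E = 1 - P ⊗ₖ (1 : Matrix N N ℂ) := by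
    rw [hE, sub_kronecker_one, Matrix.one_kronecker_one]
  have hρP : embed ρ * (P ⊗ₖ (1 : Matrix N N ℂ)) = embed ρ := by
    rw [hE1, mul_sub, mul_one, sub_eq_zero] at hρE
    exact hρE.symm
  have hPρ : (P ⊗ₖ (1 : Matrix N N ℂ)) * embed ρ = embed ρ := by
    have := congrArg Matrix.conjTranspose hρP
    rwa [Matrix.conjTranspose_mul, kronecker_one_conjTranspose, hP,
      show (embed ρ)ᴴ = embed ρ from hρ.isSelfAdjoint.star_eq] at this
  have h0 := star_left_conjugate_nonneg hρ (invSqrt σ ⊗ₖ (1 : Matrix N N ℂ))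
  rw [hstar] at h0
  have h1 := star_right_conjugate_le_conjugate ((opNorm_le_iff h0 ht0).1 ht)
    (S ⊗ₖ (1 : Matrix N N ℂ))
  rw [Matrix.star_eq_conjTranspose, kronecker_one_conjTranspose, hS, mul_smul_comm, smul_mul_assoc,
    mul_one, kronecker_one_mul, hSS] at h1
  convert h1 using 1
  calc embed ρ = (P ⊗ₖ (1 : Matrix N N ℂ)) * embed ρ * (P ⊗ₖ (1 : Matrix N N ℂ)) := by
        rw [hPρ, hρP]
    _ = _ := by
      nth_rw 1 [← hSI]
      rw [← hIS, ← kronecker_one_mul, ← kronecker_one_mul]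
      simp only [mul_assoc]

/-- The set over which the conditional min-entropy optimizes. -/
def entropyCandidates (ρ : Matrix (Fin q) (Fin q) (N → ℂ)) : Set ℝ :=
  {t : ℝ | ∃ σ : Matrix (Fin q) (Fin q) ℂ, IsState σ ∧
      (∀ v : Fin q → ℂ, σ.mulVec v = 0 → (marginal ρ).mulVec v = 0) ∧
      t = opNorm ((invSqrt σ ⊗ₖ (1 : Matrix N N ℂ)) * embed ρ *
        (invSqrt σ ⊗ₖ (1 : Matrix N N ℂ)))}

theorem condMinEntropy_eq (ρ : Matrix (Fin q) (Fin q) (N → ℂ)) :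
    condMinEntropy ρ = - Real.logb 2 (sInf (entropyCandidates ρ)) := rfl

theorem IsState.nonneg {n : Type*} [Fintype n] [DecidableEq n] {σ : Matrix n n ℂ} (h : IsState σ) :
    0 ≤ σ := Matrix.nonneg_iff_posSemidef.2 h.1

theorem one_le_mul_card {ρ : Matrix (Fin q) (Fin q) (N → ℂ)} (hρ : IsCQState ρ)
    {σ : Matrix (Fin q) (Fin q) ℂ} (hσ : IsState σ) {t : ℝ}
    (h : embed ρ ≤ t • (σ ⊗ₖ (1 : Matrix N N ℂ))) : 1 ≤ t * Fintype.card N := by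
  have := re_trace_le_re_trace h
  rw [hρ.2, Matrix.trace_smul, Matrix.trace_kronecker, hσ.2] at this
  simpa using this

theorem exists_of_mem_entropyCandidates {ρ : Matrix (Fin q) (Fin q) (N → ℂ)} (hρ : IsCQState ρ)
    {t : ℝ} (ht : t ∈ entropyCandidates ρ) :
    ∃ σ, IsState σ ∧ embed ρ ≤ t • (σ ⊗ₖ (1 : Matrix N N ℂ)) := by
  obtain ⟨σ, hσ, hker, rfl⟩ := ht
  exact ⟨σ, hσ, embed_le_of_opNorm_invSqrt_le hρ.nonneg hσ.nonneg hker (opNorm_nonneg _) le_rfl⟩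

/-- Comes from taking traces in `ρ ≤ t σ ⊗ 1`. It keeps the infimum positive, away from the default
value of the logarithm at `0`. -/
theorem inv_card_le_of_mem_entropyCandidates {ρ : Matrix (Fin q) (Fin q) (N → ℂ)}
    (hρ : IsCQState ρ) {t : ℝ} (ht : t ∈ entropyCandidates ρ) :
    0 < (Fintype.card N : ℝ)⁻¹ ∧ (Fintype.card N : ℝ)⁻¹ ≤ t := by
  obtain ⟨σ, hσ, h⟩ := exists_of_mem_entropyCandidates hρ ht
  have h1 := one_le_mul_card hρ hσ h
  have h2 : 0 < (Fintype.card N : ℝ) := by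
    rcases (Nat.cast_nonneg (α := ℝ) (Fintype.card N)).eq_or_lt with h | h
    · rw [← h] at h1; norm_num at h1
    · exact h
  exact ⟨inv_pos.2 h2, (inv_le_iff_one_le_mul₀ h2).2 h1⟩

/-- The maximally mixed state. -/
def mixed (q : ℕ) : Matrix (Fin q) (Fin q) ℂ := (q : ℝ)⁻¹ • (1 : Matrix (Fin q) (Fin q) ℂ)

theorem mixed_posDef (hq : q ≠ 0) : (mixed q).PosDef :=
  Matrix.PosDef.one.smul (inv_pos.2 (by positivity))

theorem mixed_isState (hq : q ≠ 0) : IsState (mixed q) := by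
  refine ⟨(mixed_posDef hq).posSemidef, ?_⟩
  rw [mixed, Matrix.trace_smul, Matrix.trace_one]
  have : (q : ℂ) ≠ 0 := by exact_mod_cast hq
  simp [this]

theorem ker_le_of_posDef {σ τ : Matrix (Fin q) (Fin q) ℂ} (hσ : σ.PosDef) (v : Fin q → ℂ)
    (h : σ.mulVec v = 0) : τ.mulVec v = 0 := by
  have : v = 0 := Matrix.mulVec_injective_of_isUnit hσ.isUnit (by simpa using h)
  rw [this, Matrix.mulVec_zero]

theorem IsCQState.dim_ne_zero {ρ : Matrix (Fin q) (Fin q) (N → ℂ)} (hρ : IsCQState ρ) :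
    q ≠ 0 := by
  rintro rfl
  have := hρ.2
  simp [Matrix.trace] at this

theorem entropyCandidates_nonempty {ρ : Matrix (Fin q) (Fin q) (N → ℂ)} (hρ : IsCQState ρ) :
    (entropyCandidates ρ).Nonempty :=
  ⟨_, mixed q, mixed_isState hρ.dim_ne_zero, ker_le_of_posDef (mixed_posDef hρ.dim_ne_zero), rfl⟩

theorem sInf_entropyCandidates_pos {ρ : Matrix (Fin q) (Fin q) (N → ℂ)} (hρ : IsCQState ρ) :
    0 < sInf (entropyCandidates ρ) := by
  obtain ⟨t, ht⟩ := entropyCandidates_nonempty hρ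
  exact (inv_card_le_of_mem_entropyCandidates hρ ht).1.trans_le
    (le_csInf ⟨t, ht⟩ fun s hs => (inv_card_le_of_mem_entropyCandidates hρ hs).2)

theorem le_condMinEntropy {ρ : Matrix (Fin q) (Fin q) (N → ℂ)} (hρ : IsCQState ρ)
    {σ : Matrix (Fin q) (Fin q) ℂ} (hσ : IsState σ) (hσ' : σ.PosDef) {κ : ℝ}
    (h : embed ρ ≤ ((2 : ℝ) ^ (-κ)) • (σ ⊗ₖ (1 : Matrix N N ℂ))) : κ ≤ condMinEntropy ρ := by
  have h1 : sInf (entropyCandidates ρ) ≤ (2 : ℝ) ^ (-κ) :=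
    (csInf_le ⟨_, fun s hs => (inv_card_le_of_mem_entropyCandidates hρ hs).2⟩
      ⟨σ, hσ, ker_le_of_posDef hσ', rfl⟩).trans
      (opNorm_invSqrt_le hρ.nonneg hσ' (by positivity) h).2
  have h2 := (Real.logb_le_iff_le_rpow one_lt_two (sInf_entropyCandidates_pos hρ)).2 h1
  rw [condMinEntropy_eq]
  linarith

/-- The slack `δ` makes it unnecessary to know that the infimum is attained. -/
theorem exists_of_le_condMinEntropy {ρ : Matrix (Fin q) (Fin q) (N → ℂ)} (hρ : IsCQState ρ)
    {κ : ℝ} (h : κ ≤ condMinEntropy ρ) {δ : ℝ} (hδ : 0 < δ) :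
    ∃ σ, IsState σ ∧ embed ρ ≤ ((2 : ℝ) ^ (-κ) + δ) • (σ ⊗ₖ (1 : Matrix N N ℂ)) := by
  rw [condMinEntropy_eq] at h
  have h1 : sInf (entropyCandidates ρ) ≤ (2 : ℝ) ^ (-κ) :=
    (Real.logb_le_iff_le_rpow one_lt_two (sInf_entropyCandidates_pos hρ)).1 (by linarith)
  obtain ⟨t, ht, hlt⟩ := Real.lt_sInf_add_pos (entropyCandidates_nonempty hρ) hδ
  obtain ⟨σ, hσ, hle⟩ := exists_of_mem_entropyCandidates hρ ht
  exact ⟨σ, hσ, hle.trans (real_smul_le (by linarith) (kronecker_one_nonneg hσ.nonneg))⟩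

end MinEntropy

/-! ### The unit ball of `∩·∩{K ℓ_∞, ℓ_1}`. -/

section Factorizations

variable {q : ℕ} {N : Type*} [Fintype N] [DecidableEq N]

theorem factorNorm_nonneg (K : ℝ) (a : Matrix (Fin q × N) (Fin q × N) ℂ) : 0 ≤ factorNorm K a :=
  le_max_of_le_right (opNorm_nonneg _)

theorem factorNorm_smul (K r : ℝ) (a : Matrix (Fin q × N) (Fin q × N) ℂ) :
    factorNorm K (r • a) = |r| * factorNorm K a := by
  have h : Gam (r • a) = r • Gam a := rfl
  rw [factorNorm, factorNorm, h, opNorm_smul, opNorm_smul, mul_max_of_nonneg _ _ (abs_nonneg r),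
    mul_left_comm]

theorem factorNorm_eq_zero {K : ℝ} (hK : 0 < K) {a : Matrix (Fin q × N) (Fin q × N) ℂ}
    (h : factorNorm K a = 0) : a = 0 := by
  have h1 : √K * opNorm a ≤ 0 := h ▸ le_max_left _ _
  exact opNorm_eq_zero.1 (le_antisymm (nonpos_of_mul_nonpos_right h1 (Real.sqrt_pos.2 hK))
    (opNorm_nonneg a))

theorem factorNorm_le_sqrt_iff {K : ℝ} (hK : 0 < K) {c : ℝ} (hc : 0 ≤ c)
    {a : Matrix (Fin q × N) (Fin q × N) ℂ} :
    factorNorm K a ≤ √c ↔ a * aᴴ ≤ (c / K) • (1 : Matrix (Fin q × N) (Fin q × N) ℂ) ∧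
      marginal (diagPart (a * aᴴ)) ≤ c • (1 : Matrix (Fin q) (Fin q) ℂ) := by
  rw [factorNorm, max_le_iff, mul_comm, ← le_div_iff₀ (Real.sqrt_pos.2 hK),
    opNorm_le_iff_mul_conjTranspose (by positivity),
    opNorm_le_iff_mul_conjTranspose (Real.sqrt_nonneg c), Gam_mul_conjTranspose_self, div_pow,
    Real.sq_sqrt hc, Real.sq_sqrt hK.le]

/-- A positive `x` has the symmetric factorization `√x √x`, for which `a aᴴ` is `x` itself. -/
theorem capCap_le_one {K : ℝ} (hK : 0 < K) {x : Matrix (Fin q) (Fin q) (N → ℂ)}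
    (h0 : 0 ≤ embed x) (h1 : embed x ≤ K⁻¹ • (1 : Matrix (Fin q × N) (Fin q × N) ℂ))
    (h2 : marginal x ≤ 1) : capCap N K q x ≤ 1 := by
  obtain ⟨a, ha, haa⟩ : ∃ a, aᴴ = a ∧ a * a = embed x :=
    ⟨CFC.sqrt (embed x), (CFC.sqrt_nonneg (embed x)).isSelfAdjoint.star_eq,
      CFC.sqrt_mul_sqrt_self (embed x)⟩
  have haa' : a * aᴴ = embed x := by rw [ha, haa]
  have h3 : factorNorm K a ≤ 1 := by
    rw [← Real.sqrt_one, factorNorm_le_sqrt_iff hK zero_le_one, haa', diagPart_embed, one_div,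
      one_smul]
    exact ⟨h1, h2⟩
  unfold capCap
  refine iInf_le_of_le a (iInf_le_of_le a (iInf_le_of_le haa'.symm ?_))
  rw [ENNReal.ofReal_le_one]
  exact mul_le_one₀ h3 (factorNorm_nonneg K a) h3

theorem exists_factorization {K : ℝ} (hK : 0 < K) {x : Matrix (Fin q) (Fin q) (N → ℂ)}
    (hx : capCap N K q x ≤ 1) {c : ℝ} (hc : 1 < c) :
    ∃ a b : Matrix (Fin q × N) (Fin q × N) ℂ, embed x = a * bᴴ ∧
      factorNorm K a ≤ √c ∧ factorNorm K b ≤ √c := by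
  have h1 : capCap N K q x < ENNReal.ofReal c :=
    hx.trans_lt (by rwa [← ENNReal.ofReal_one, ENNReal.ofReal_lt_ofReal_iff (by linarith)])
  simp only [capCap, iInf_lt_iff] at h1
  obtain ⟨a, b, hab, h⟩ := h1
  have h2 : factorNorm K a * factorNorm K b < c :=
    (ENNReal.ofReal_lt_ofReal_iff (by linarith)).1 h
  have hc0 : 0 < √c := Real.sqrt_pos.2 (by linarith)
  -- The two factors are balanced by rescaling with `r` and `r⁻¹`. This fails only if `a = 0`; then
  -- `x = 0` and both factors may be taken zero.
  rcases (factorNorm_nonneg K a).eq_or_lt with h0 | h0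
  · have ha : a = 0 := factorNorm_eq_zero hK h0.symm
    have hz : factorNorm K (0 : Matrix (Fin q × N) (Fin q × N) ℂ) = 0 := by rw [← ha, ← h0]
    exact ⟨0, 0, by rw [hab, ha]; simp, hz ▸ hc0.le, hz ▸ hc0.le⟩
  · set r := √c / factorNorm K a with hr
    have hr0 : 0 < r := div_pos hc0 h0
    refine ⟨r • a, r⁻¹ • b, ?_, ?_, ?_⟩
    · rw [Matrix.conjTranspose_smul, smul_mul_smul_comm, star_trivial, mul_inv_cancel₀ hr0.ne',
        one_smul, hab]
    · rw [factorNorm_smul, abs_of_pos hr0, hr, div_mul_cancel₀ _ h0.ne']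
    · rw [factorNorm_smul, abs_of_pos (inv_pos.2 hr0), hr, inv_div, div_mul_eq_mul_div,
        div_le_iff₀ hc0, Real.mul_self_sqrt (by linarith)]
      exact h2.le

theorem kronecker_mul_factor_le {K : ℝ} (hK : 0 < K) {c : ℝ} (hc : 0 ≤ c)
    {a : Matrix (Fin q × N) (Fin q × N) ℂ} (ha : factorNorm K a ≤ √c)
    (A : Matrix (Fin q) (Fin q) ℂ) :
    ((A ⊗ₖ (1 : Matrix N N ℂ)) * a) * ((A ⊗ₖ (1 : Matrix N N ℂ)) * a)ᴴ ≤
        (c / K) • ((A * Aᴴ) ⊗ₖ (1 : Matrix N N ℂ)) ∧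
      (((A ⊗ₖ (1 : Matrix N N ℂ)) * a) * ((A ⊗ₖ (1 : Matrix N N ℂ)) * a)ᴴ).trace.re ≤
        c * (A * Aᴴ).trace.re := by
  obtain ⟨h1, h2⟩ := (factorNorm_le_sqrt_iff hK hc).1 ha
  have he : ((A ⊗ₖ (1 : Matrix N N ℂ)) * a) * ((A ⊗ₖ (1 : Matrix N N ℂ)) * a)ᴴ =
      (A ⊗ₖ (1 : Matrix N N ℂ)) * (a * aᴴ) * (Aᴴ ⊗ₖ (1 : Matrix N N ℂ)) := by
    rw [Matrix.conjTranspose_mul, kronecker_one_conjTranspose]; simp only [mul_assoc]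
  rw [he]
  constructor
  · have h3 := star_right_conjugate_le_conjugate h1 (A ⊗ₖ (1 : Matrix N N ℂ))
    rwa [Matrix.star_eq_conjTranspose, kronecker_one_conjTranspose, mul_smul_comm, smul_mul_assoc,
      mul_one, kronecker_one_mul] at h3
  · rw [← trace_marginal_diagPart, diagPart_kronecker_mul_mul, marginal_sandwich]
    have h3 := re_trace_le_re_trace (star_right_conjugate_le_conjugate h2 A)
    rwa [Matrix.star_eq_conjTranspose, mul_smul_comm, smul_mul_assoc, mul_one, Matrix.trace_smul,
      Complex.smul_re, smul_eq_mul] at h3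

end Factorizations

/-! ### From the completely bounded norm to the extractor property. -/

section Extraction

variable {q : ℕ} {N M D : Type*} [Fintype N] [Fintype M] [Fintype D] [DecidableEq N] [DecidableEq M]

theorem isQuantumProof_iff (k ε : ℝ) (f : D → N → M) : IsQuantumProof k ε f ↔
    ∀ (q : ℕ) (ρ : Matrix (Fin q) (Fin q) (N → ℂ)), IsCQState ρ → k ≤ condMinEntropy ρ →
      traceNorm (embed (ρ.map (Delta f))) ≤ ε := by
  have h (q : ℕ) (ρ : Matrix (Fin q) (Fin q) (N → ℂ)) :
      (Fintype.card D : ℂ)⁻¹ • ∑ s, ρ.map (pushMap (f s)) -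
        (marginal ρ).map (fun c => c • uniform M) = ρ.map (Delta f) := by
    ext i j y
    simp [Delta, marginal, Matrix.sum_apply]
  simp only [IsQuantumProof, h]

theorem traceNorm_real_smul {n : Type*} [Fintype n] [DecidableEq n] (r : ℝ) (A : Matrix n n ℂ) :
    traceNorm (r • A) = |r| * traceNorm A := by
  rw [← Complex.coe_smul, traceNorm_smul, Complex.norm_real, Real.norm_eq_abs]

theorem embed_map_add (u : (N → ℂ) →ₗ[ℂ] (M → ℂ)) (x y : Matrix (Fin q) (Fin q) (N → ℂ)) :
    embed ((x + y).map u) = embed (x.map u) + embed (y.map u) := by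
  rw [← embed_add, Matrix.map_add _ (map_add u)]

theorem embed_map_smul (u : (N → ℂ) →ₗ[ℂ] (M → ℂ)) (c : ℂ) (x : Matrix (Fin q) (Fin q) (N → ℂ)) :
    embed ((c • x).map u) = c • embed (x.map u) := by
  rw [← embed_smul]
  congr 1
  ext i j : 2
  simp

theorem embed_map_real_smul (u : (N → ℂ) →ₗ[ℂ] (M → ℂ)) (r : ℝ)
    (x : Matrix (Fin q) (Fin q) (N → ℂ)) : embed ((r • x).map u) = r • embed (x.map u) := by
  rw [← embed_smul]
  congr 1
  ext i j : 2
  simp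

/-- A bound on the completely bounded norm controls the trace norm on states, up to the trace of any
positive definite matrix that dominates both the marginal and `K ρ`. -/
theorem traceNorm_map_le_of_cbNorm_le {K ε : ℝ} (hK : 0 < K) (hε : 0 ≤ ε)
    {u : (N → ℂ) →ₗ[ℂ] (M → ℂ)} (hu : cbNorm (capCap N K) (ellOne M) u ≤ ENNReal.ofReal ε)
    {ρ : Matrix (Fin q) (Fin q) (N → ℂ)} (hρ : 0 ≤ embed ρ) {σ : Matrix (Fin q) (Fin q) ℂ}
    (hσ : σ.PosDef) (h1 : embed ρ ≤ K⁻¹ • (σ ⊗ₖ (1 : Matrix N N ℂ))) (h2 : marginal ρ ≤ σ)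
    (hT : 0 < σ.trace.re) :
    traceNorm (embed (ρ.map u)) ≤ σ.trace.re * ε := by
  obtain ⟨S, hS, hSS, hSI, hIS⟩ := exists_sqrt_mul_invSqrt_of_posDef hσ
  set x := sandwich (invSqrt σ) ρ (invSqrt σ) with hx
  set T := σ.trace.re with hTdef
  have hK' : 0 ≤ K⁻¹ := (inv_pos.2 hK).le
  obtain ⟨hx0, hx1⟩ := opNorm_invSqrt_le hρ hσ hK' h1
  have hx2 := (opNorm_le_iff hx0 hK').1 hx1
  rw [← embed_sandwich] at hx0 hx2
  have hx3 : marginal x ≤ 1 := by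
    rw [hx, marginal_sandwich, ← invSqrt_mul_mul_invSqrt hσ]
    have h3 := star_left_conjugate_le_conjugate h2 (invSqrt σ)
    rwa [Matrix.star_eq_conjTranspose, invSqrt_conjTranspose] at h3
  have hcap : capCap N K q x ≤ 1 := capCap_le_one hK hx0 hx2 hx3
  have hell : ellOne M q (x.map u) ≤ ENNReal.ofReal ε := by
    refine le_trans ?_ hu
    exact le_iSup_of_le q (le_iSup_of_le x (le_iSup_of_le hcap le_rfl))
  -- Here `Tr (S S) = Tr σ = T`, so `A` is a unit vector in Hilbert-Schmidt norm, and it undoes the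
  -- conjugation by `σ ^ (-1/2)` up to `T⁻¹`.
  set A := (√T)⁻¹ • S with hA
  have hA1 : hsNorm A ≤ 1 := by
    rw [hsNorm, hA, Matrix.conjTranspose_smul, hS, smul_mul_smul_comm, star_trivial, hSS,
      Matrix.trace_smul, Complex.smul_re, ← hTdef, ← mul_inv, Real.mul_self_sqrt hT.le, smul_eq_mul,
      inv_mul_cancel₀ hT.ne', Real.sqrt_one]
  have htr : traceNorm ((A ⊗ₖ (1 : Matrix M M ℂ)) * embed (x.map u) *
      (A ⊗ₖ (1 : Matrix M M ℂ))) ≤ ε := by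
    refine (ENNReal.ofReal_le_ofReal_iff hε).1 (le_trans ?_ hell)
    exact le_iSup_of_le A (le_iSup_of_le A (le_iSup_of_le hA1 (le_iSup_of_le hA1 le_rfl)))
  have hρx : sandwich S x S = ρ := by
    rw [← diagPart_embed (sandwich S x S), embed_sandwich, hx, embed_sandwich]
    have : (S ⊗ₖ (1 : Matrix N N ℂ)) * ((invSqrt σ ⊗ₖ (1 : Matrix N N ℂ)) * embed ρ *
        (invSqrt σ ⊗ₖ (1 : Matrix N N ℂ))) * (S ⊗ₖ (1 : Matrix N N ℂ)) =
        ((S ⊗ₖ (1 : Matrix N N ℂ)) * (invSqrt σ ⊗ₖ (1 : Matrix N N ℂ))) * embed ρ *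
        ((invSqrt σ ⊗ₖ (1 : Matrix N N ℂ)) * (S ⊗ₖ (1 : Matrix N N ℂ))) := by
      simp only [mul_assoc]
    rw [this, kronecker_one_mul, kronecker_one_mul, hSI, hIS, Matrix.one_kronecker_one, one_mul,
      mul_one, diagPart_embed]
  have hAS : (A ⊗ₖ (1 : Matrix M M ℂ)) * embed (x.map u) * (A ⊗ₖ (1 : Matrix M M ℂ)) =
      T⁻¹ • embed (ρ.map u) := by
    rw [hA, Matrix.smul_kronecker, smul_mul_assoc, smul_mul_smul_comm, ← mul_inv,
      Real.mul_self_sqrt hT.le, ← embed_sandwich, ← sandwich_map, hρx]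
  rwa [hAS, traceNorm_real_smul, abs_of_pos (inv_pos.2 hT), inv_mul_le_iff₀ hT] at htr

theorem isQuantumProof_of_cbNorm_le {k ε : ℝ} (hε : 0 ≤ ε) {f : D → N → M}
    (h : cbNorm (capCap N ((2 : ℝ) ^ k)) (ellOne M) (Delta f) ≤ ENNReal.ofReal ε) :
    IsQuantumProof k (2 * ε) f := by
  rw [isQuantumProof_iff]
  intro q ρ hρ hk
  set K := (2 : ℝ) ^ k with hKdef
  have hK : 0 < K := by positivity
  refine le_of_forall_pos_le_add fun η hη => ?_
  have hden : 0 < (K + q) * ε + 1 := by positivity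
  -- The trace of `σ` below exceeds `2` by `δ (K + q)`, so the excess error `δ (K + q) ε` is at most
  -- `η`.
  set δ := η / ((K + q) * ε + 1) with hδdef
  have hδ : 0 < δ := div_pos hη hden
  obtain ⟨σ₀, hσ₀, hle⟩ := exists_of_le_condMinEntropy hρ hk hδ
  rw [Real.rpow_neg zero_le_two, ← hKdef] at hle
  have hmarg : 0 ≤ marginal ρ := by
    have := marginal_diagPart_nonneg hρ.nonneg
    rwa [diagPart_embed] at this
  have hs0 : 0 ≤ (1 + K * δ) • σ₀ := real_smul_nonneg (by positivity) hσ₀.nonneg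
  -- The summands serve, in order, to dominate `K ρ`, to dominate the marginal, and to make `σ`
  -- invertible.
  set σ := ((1 + K * δ) • σ₀ + marginal ρ) + δ • (1 : Matrix (Fin q) (Fin q) ℂ) with hσdef
  have hσ : σ.PosDef := (Matrix.PosDef.one.smul hδ).posSemidef_add
    (Matrix.nonneg_iff_posSemidef.1 (add_nonneg hs0 hmarg))
  have hd1 : 0 ≤ δ • (1 : Matrix (Fin q) (Fin q) ℂ) :=
    real_smul_nonneg hδ.le (Matrix.nonneg_iff_posSemidef.2 Matrix.PosSemidef.one)
  have h1 : embed ρ ≤ K⁻¹ • (σ ⊗ₖ (1 : Matrix N N ℂ)) := by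
    have e : K⁻¹ + δ = K⁻¹ * (1 + K * δ) := by field_simp
    rw [e, mul_smul, ← Matrix.smul_kronecker] at hle
    refine hle.trans (smul_le_smul_of_nonneg_left (kronecker_one_mono ?_) (inv_pos.2 hK).le)
    rw [hσdef, add_assoc]
    exact le_add_of_nonneg_right (add_nonneg hmarg hd1)
  have h2 : marginal ρ ≤ σ := by
    rw [hσdef, add_right_comm]
    exact le_add_of_nonneg_left (add_nonneg hs0 hd1)
  have htr : σ.trace.re = 2 + δ * (K + q) := by
    rw [hσdef, Matrix.trace_add, Matrix.trace_add, ← trace_embed, hρ.2, Matrix.trace_smul, hσ₀.2,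
      Matrix.trace_smul, Matrix.trace_one]
    simp
    ring
  have h3 := traceNorm_map_le_of_cbNorm_le hK hε h hρ.nonneg hσ h1 h2
    (by rw [htr]; positivity)
  rw [htr] at h3
  refine h3.trans ?_
  have h4 : δ * ((K + q) * ε + 1) = η := div_mul_cancel₀ _ hden.ne'
  nlinarith

end Extraction

/-! ### From the extractor property to the completely bounded norm. -/

section Converse

variable {q : ℕ} {N M D : Type*} [Fintype N] [Fintype M] [Fintype D] [DecidableEq N] [DecidableEq M]

/-- The product of the maximally mixed state and the uniform distribution. -/
def flatState (q : ℕ) (N : Type*) [Fintype N] [DecidableEq N] : Matrix (Fin q) (Fin q) (N → ℂ) :=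
  (Fintype.card N : ℝ)⁻¹ • diagPart (mixed q ⊗ₖ (1 : Matrix N N ℂ))

theorem embed_flatState :
    embed (flatState q N) = (Fintype.card N : ℝ)⁻¹ • (mixed q ⊗ₖ (1 : Matrix N N ℂ)) := by
  rw [flatState, embed_smul, embed_diagPart_kronecker_one]

theorem flatState_isCQState (hq : q ≠ 0) (hN : 0 < Fintype.card N) :
    IsCQState (flatState q N) := by
  have h : (Fintype.card N : ℂ) ≠ 0 := by exact_mod_cast hN.ne'
  refine ⟨Matrix.nonneg_iff_posSemidef.1 ?_, ?_⟩
  · rw [embed_flatState]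
    exact real_smul_nonneg (by positivity) (kronecker_one_nonneg (mixed_isState hq).nonneg)
  · rw [embed_flatState, Matrix.trace_smul, Matrix.trace_kronecker, (mixed_isState hq).2,
      Matrix.trace_one]
    simp [h]

theorem embed_flatState_le (hq : q ≠ 0) {K : ℝ} (hK : 0 < K) (hKN : K ≤ Fintype.card N) :
    embed (flatState q N) ≤ K⁻¹ • (mixed q ⊗ₖ (1 : Matrix N N ℂ)) := by
  rw [embed_flatState]
  exact real_smul_le (inv_anti₀ hK hKN) (kronecker_one_nonneg (mixed_isState hq).nonneg)

theorem two_rpow_neg_sub_one (k : ℝ) : (2 : ℝ) ^ (-(k - 1)) = 2 * ((2 : ℝ) ^ k)⁻¹ := by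
  rw [neg_sub, sub_eq_add_neg, Real.rpow_add two_pos, Real.rpow_one, Real.rpow_neg zero_le_two]

/-- A quantum-proof extractor controls all subnormalized classical-quantum operators dominated by
`(s / K) C ⊗ 1` with `Tr C ≤ 1`, by completing them to a state with a flat one. -/
theorem traceNorm_map_le_of_isQuantumProof {k ε : ℝ} (hε : 0 ≤ ε) {f : D → N → M}
    (hf : IsQuantumProof (k - 1) ε f) (hkN : (2 : ℝ) ^ k ≤ Fintype.card N)
    {ρ : Matrix (Fin q) (Fin q) (N → ℂ)} (hρ : 0 ≤ embed ρ) {C : Matrix (Fin q) (Fin q) ℂ}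
    (hC : 0 ≤ C) (hCtr : C.trace.re ≤ 1) {s : ℝ} (hs : 0 < s) (hρs : (embed ρ).trace.re ≤ s)
    (hρC : embed ρ ≤ (s / (2 : ℝ) ^ k) • (C ⊗ₖ (1 : Matrix N N ℂ))) :
    traceNorm (embed (ρ.map (Delta f))) ≤ 2 * s * ε := by
  rcases eq_or_ne q 0 with rfl | hq
  · have : embed (ρ.map (Delta f)) = 0 := Subsingleton.elim _ _
    rw [this, traceNorm_zero]; positivity
  rw [isQuantumProof_iff] at hf
  set K := (2 : ℝ) ^ k with hKdef
  have hK : 0 < K := by positivity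
  have hN : 0 < Fintype.card N := by exact_mod_cast hK.trans_le hkN
  have hω := mixed_isState hq
  have hω1 : 0 ≤ mixed q ⊗ₖ (1 : Matrix N N ℂ) := kronecker_one_nonneg hω.nonneg
  have hflat := flatState_isCQState (N := N) hq hN
  have hflat_le := embed_flatState_le hq hK hkN
  set F := flatState q N
  set τ := (embed ρ).trace.re with hτ
  have hτ0 : 0 ≤ τ := by simpa using re_trace_le_re_trace hρ
  have hτc : (embed ρ).trace = (τ : ℂ) := by
    refine Complex.ext rfl ?_
    rw [Complex.ofReal_im]
    exact (Complex.le_def.1 (Matrix.nonneg_iff_posSemidef.1 hρ).trace_nonneg).2.symm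
  have hpow := two_rpow_neg_sub_one k
  rw [← hKdef] at hpow
  have hFε : traceNorm (embed (F.map (Delta f))) ≤ ε := by
    refine hf q F hflat (le_condMinEntropy hflat hω (mixed_posDef hq) ?_)
    rw [hpow]
    refine hflat_le.trans (real_smul_le ?_ hω1)
    linarith [inv_pos.2 hK]
  -- The flat state supplies the missing trace `s - τ`.
  set ρ' := s⁻¹ • (ρ + (s - τ) • F) with hρ'
  have heρ' : embed ρ' = s⁻¹ • (embed ρ + (s - τ) • embed F) := by
    rw [hρ', embed_smul, embed_add, embed_smul]
  have hstate : IsCQState ρ' := by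
    refine ⟨Matrix.nonneg_iff_posSemidef.1 ?_, ?_⟩
    · rw [heρ']
      exact real_smul_nonneg (inv_pos.2 hs).le
        (add_nonneg hρ (real_smul_nonneg (by linarith) hflat.nonneg))
    · rw [heρ', Matrix.trace_smul, Matrix.trace_add, Matrix.trace_smul, hflat.2, hτc]
      have : (s : ℂ) ≠ 0 := by exact_mod_cast hs.ne'
      simp [this]
  -- `C + mixed q` dominates `K ρ'` but may have trace below `2`; more of the mixed state normalizes
  -- it. The factor `2⁻¹` is the lost bit of entropy.
  set σ := (2 : ℝ)⁻¹ • (C + (2 - C.trace.re) • mixed q) with hσdef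
  have hσpd : σ.PosDef := by
    refine Matrix.PosDef.smul ?_ (by norm_num)
    exact ((mixed_posDef hq).smul (by linarith)).posSemidef_add (Matrix.nonneg_iff_posSemidef.1 hC)
  have hCc : C.trace = (C.trace.re : ℂ) := by
    refine Complex.ext rfl ?_
    rw [Complex.ofReal_im]
    exact (Complex.le_def.1 (Matrix.nonneg_iff_posSemidef.1 hC).trace_nonneg).2.symm
  have hσ : IsState σ := by
    refine ⟨hσpd.posSemidef, ?_⟩
    rw [hσdef, Matrix.trace_smul, Matrix.trace_add, Matrix.trace_smul, hω.2, hCc]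
    simp
  have hρ'le : embed ρ' ≤ (2 * K⁻¹) • (σ ⊗ₖ (1 : Matrix N N ℂ)) := by
    have e1 : (2 * K⁻¹) • (σ ⊗ₖ (1 : Matrix N N ℂ)) =
        K⁻¹ • (C ⊗ₖ (1 : Matrix N N ℂ)) +
          (K⁻¹ * (2 - C.trace.re)) • (mixed q ⊗ₖ (1 : Matrix N N ℂ)) := by
      rw [hσdef, Matrix.smul_kronecker, Matrix.add_kronecker, Matrix.smul_kronecker, smul_smul,
        smul_add, smul_smul]
      congr 2 <;> ring
    have e2 : s⁻¹ • ((s / K) • (C ⊗ₖ (1 : Matrix N N ℂ)) +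
        (s - τ) • K⁻¹ • (mixed q ⊗ₖ (1 : Matrix N N ℂ))) =
        K⁻¹ • (C ⊗ₖ (1 : Matrix N N ℂ)) +
          (K⁻¹ * (s⁻¹ * (s - τ))) • (mixed q ⊗ₖ (1 : Matrix N N ℂ)) := by
      rw [smul_add, smul_smul, smul_smul, smul_smul]
      congr 2 <;> field_simp
    rw [heρ', e1]
    refine le_trans (smul_le_smul_of_nonneg_left (add_le_add hρC
      (smul_le_smul_of_nonneg_left hflat_le (by linarith))) (inv_pos.2 hs).le) ?_
    rw [e2]
    refine add_le_add le_rfl (real_smul_le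
      (mul_le_mul_of_nonneg_left ?_ (inv_pos.2 hK).le) hω1)
    have : s⁻¹ * (s - τ) ≤ 1 := by
      rw [inv_mul_le_iff₀ hs]; linarith
    linarith
  have hρ'ε : traceNorm (embed (ρ'.map (Delta f))) ≤ ε := by
    refine hf q ρ' hstate (le_condMinEntropy hstate hσ hσpd ?_)
    rwa [hpow]
  have hdecomp : ρ = s • ρ' + (-(s - τ)) • F := by
    rw [hρ', smul_inv_smul₀ hs.ne', add_assoc, ← add_smul, add_neg_cancel, zero_smul, add_zero]
  have hsum : embed (ρ.map (Delta f)) =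
      s • embed (ρ'.map (Delta f)) + (-(s - τ)) • embed (F.map (Delta f)) := by
    rw [← embed_map_real_smul, ← embed_map_real_smul, ← embed_map_add, ← hdecomp]
  rw [hsum]
  refine (traceNorm_add_le _ _).trans ?_
  rw [traceNorm_real_smul, traceNorm_real_smul, abs_of_pos hs, abs_neg, abs_of_nonneg (by linarith)]
  have h1 : s * traceNorm (embed (ρ'.map (Delta f))) ≤ s * ε :=
    mul_le_mul_of_nonneg_left hρ'ε hs.le
  have h2 : (s - τ) * traceNorm (embed (F.map (Delta f))) ≤ (s - τ) * ε :=
    mul_le_mul_of_nonneg_left hFε (by linarith)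
  have h3 : 0 ≤ τ * ε := mul_nonneg hτ0 hε
  linarith

theorem add_smul_mul_conjTranspose {n : Type*} [Fintype n] (a b : Matrix n n ℂ) {z : ℂ}
    (hz : z * star z = 1) :
    (a + z • b) * (a + z • b)ᴴ = a * aᴴ + star z • (a * bᴴ) + z • (b * aᴴ) + b * bᴴ := by
  rw [Matrix.conjTranspose_add, Matrix.conjTranspose_smul, add_mul, mul_add, mul_add,
    smul_mul_smul_comm, hz, one_smul, mul_smul_comm, smul_mul_assoc, ← add_assoc]

/-- Over the fourth roots of unity the sums of `z` and `z²` vanish, so only the four copies of `a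
bᴴ` survive. -/
theorem polarization {n : Type*} [Fintype n] (a b : Matrix n n ℂ) :
    a * bᴴ = (4 : ℂ)⁻¹ • ((a + (1 : ℂ) • b) * (a + (1 : ℂ) • b)ᴴ +
      (-1 : ℂ) • ((a + (-1 : ℂ) • b) * (a + (-1 : ℂ) • b)ᴴ) +
      Complex.I • ((a + Complex.I • b) * (a + Complex.I • b)ᴴ) +
      (-Complex.I) • ((a + (-Complex.I) • b) * (a + (-Complex.I) • b)ᴴ)) := by
  rw [eq_inv_smul_iff₀ (by norm_num)]
  have h (z : ℂ) (hz : z * star z = 1) : z • ((a + z • b) * (a + z • b)ᴴ) =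
      z • (a * aᴴ) + a * bᴴ + (z * z) • (b * aᴴ) + z • (b * bᴴ) := by
    rw [add_smul_mul_conjTranspose a b hz]
    simp only [smul_add, smul_smul, hz, one_smul]
  have h1 := h 1 (by simp)
  rw [one_smul ℂ ((a + (1 : ℂ) • b) * (a + (1 : ℂ) • b)ᴴ)] at h1
  rw [h1, h (-1) (by simp), h Complex.I (by simp), h (-Complex.I) (by simp)]
  simp only [neg_mul_neg, Complex.I_mul_I, one_mul, neg_smul, one_smul]
  module

/-- Parallelogram identity: the difference of the two sides is the square belonging to `-z`. -/
theorem add_smul_mul_conjTranspose_le {n : Type*} [Fintype n] (a b : Matrix n n ℂ) {z : ℂ}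
    (hz : z * star z = 1) :
    (a + z • b) * (a + z • b)ᴴ ≤ (2 : ℝ) • (a * aᴴ + b * bᴴ) := by
  have h0 : 0 ≤ (a + (-z) • b) * (a + (-z) • b)ᴴ :=
    Matrix.nonneg_iff_posSemidef.2 (Matrix.posSemidef_self_mul_conjTranspose _)
  have h1 : (2 : ℝ) • (a * aᴴ + b * bᴴ) - (a + z • b) * (a + z • b)ᴴ =
      (a + (-z) • b) * (a + (-z) • b)ᴴ := by
    rw [add_smul_mul_conjTranspose a b hz,
      add_smul_mul_conjTranspose a b (z := -z) (by rwa [star_neg, neg_mul_neg]), star_neg, neg_smul,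
      neg_smul, two_smul]
    abel
  rw [← sub_nonneg, h1]
  exact h0

theorem traceNorm_sandwich_map_le {k ε : ℝ} (hε : 0 ≤ ε) {f : D → N → M}
    (hf : IsQuantumProof (k - 1) ε f) (hkN : (2 : ℝ) ^ k ≤ Fintype.card N)
    {x : Matrix (Fin q) (Fin q) (N → ℂ)} (hx : capCap N ((2 : ℝ) ^ k) q x ≤ 1)
    {A B : Matrix (Fin q) (Fin q) ℂ} (hA : hsNorm A ≤ 1) (hB : hsNorm B ≤ 1) {c : ℝ} (hc : 1 < c) :
    traceNorm (embed ((sandwich A x B).map (Delta f))) ≤ 8 * c * ε := by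
  have hK : 0 < (2 : ℝ) ^ k := by positivity
  have hc0 : 0 < c := by linarith
  obtain ⟨a, b, hab, ha, hb⟩ := exists_factorization hK hx hc
  obtain ⟨ha1, ha2⟩ := kronecker_mul_factor_le hK hc0.le ha A
  obtain ⟨hb1, hb2⟩ := kronecker_mul_factor_le hK hc0.le hb Bᴴ
  set α := (A ⊗ₖ (1 : Matrix N N ℂ)) * a with hα
  set β := (Bᴴ ⊗ₖ (1 : Matrix N N ℂ)) * b with hβ
  rw [Matrix.conjTranspose_conjTranspose] at hb1 hb2
  have hAtr : (A * Aᴴ).trace.re ≤ 1 := by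
    rw [Matrix.trace_mul_comm]
    simpa using (Real.sqrt_le_iff.1 hA).2
  have hBtr : (Bᴴ * B).trace.re ≤ 1 := by
    simpa using (Real.sqrt_le_iff.1 hB).2
  -- The average has trace at most one. With the factor `2` of the parallelogram bound this leads to
  -- `s = 4 c` below.
  set C := (2 : ℝ)⁻¹ • (A * Aᴴ + Bᴴ * B) with hCdef
  have hC : 0 ≤ C := real_smul_nonneg (by norm_num) (add_nonneg
    (Matrix.nonneg_iff_posSemidef.2 (Matrix.posSemidef_self_mul_conjTranspose A))
    (Matrix.nonneg_iff_posSemidef.2 (Matrix.posSemidef_conjTranspose_mul_self B)))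
  have hCtr : C.trace.re ≤ 1 := by
    rw [hCdef, Matrix.trace_smul, Matrix.trace_add, Complex.smul_re, Complex.add_re, smul_eq_mul]
    linarith
  have key (z : ℂ) (hz : z * star z = 1) :
      traceNorm (embed ((diagPart ((α + z • β) * (α + z • β)ᴴ)).map (Delta f))) ≤ 8 * c * ε := by
    have hY0 : 0 ≤ (α + z • β) * (α + z • β)ᴴ :=
      Matrix.nonneg_iff_posSemidef.2 (Matrix.posSemidef_self_mul_conjTranspose _)
    have hY := add_smul_mul_conjTranspose_le α β hz
    have h := traceNorm_map_le_of_isQuantumProof (s := 4 * c) hε hf hkN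
      (embed_diagPart_nonneg hY0) hC hCtr (by linarith) ?_ ?_
    · refine h.trans (le_of_eq ?_); ring
    · rw [trace_embed, trace_marginal_diagPart]
      refine (re_trace_le_re_trace hY).trans ?_
      rw [Matrix.trace_smul, Matrix.trace_add, Complex.smul_re, Complex.add_re, smul_eq_mul]
      nlinarith
    · have e : (4 * c / (2 : ℝ) ^ k) • (C ⊗ₖ (1 : Matrix N N ℂ)) =
          (2 : ℝ) • ((c / (2 : ℝ) ^ k) • ((A * Aᴴ) ⊗ₖ (1 : Matrix N N ℂ)) +
            (c / (2 : ℝ) ^ k) • ((Bᴴ * B) ⊗ₖ (1 : Matrix N N ℂ))) := by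
        rw [hCdef, Matrix.smul_kronecker, Matrix.add_kronecker, smul_smul, ← smul_add, smul_smul]
        congr 1; ring
      have h1 : (α + z • β) * (α + z • β)ᴴ ≤
          (4 * c / (2 : ℝ) ^ k) • (C ⊗ₖ (1 : Matrix N N ℂ)) := by
        rw [e]
        exact hY.trans (smul_le_smul_of_nonneg_left (add_le_add ha1 hb1) zero_le_two)
      rw [← Matrix.smul_kronecker] at h1 ⊢
      -- Pinching preserves the order and fixes `C ⊗ 1`, so the bound passes to the diagonal part.
      have h2 := embed_diagPart_mono h1
      rwa [embed_diagPart_kronecker_one] at h2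
  have hαβ : sandwich A x B = diagPart (α * βᴴ) := by
    rw [← diagPart_embed (sandwich A x B), embed_sandwich, hab, hα, hβ, Matrix.conjTranspose_mul,
      kronecker_one_conjTranspose, Matrix.conjTranspose_conjTranspose]
    simp only [mul_assoc]
  have hadd (Y Z : Matrix (Fin q × N) (Fin q × N) ℂ) :
      diagPart (Y + Z) = diagPart Y + diagPart Z := rfl
  have hsmul (z : ℂ) (Y : Matrix (Fin q × N) (Fin q × N) ℂ) :
      diagPart (z • Y) = z • diagPart Y := rfl
  rw [hαβ, polarization α β]
  simp only [hadd, hsmul, embed_map_add, embed_map_smul]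
  rw [traceNorm_smul]
  have k1 := key 1 (by simp)
  have k2 := key (-1) (by simp)
  have k3 := key Complex.I (by simp)
  have k4 := key (-Complex.I) (by simp)
  -- Four terms with unimodular coefficients, each at most `8 c ε`; the prefactor `1 / 4` averages
  -- them.
  have t1 := fun (X Y Z W : Matrix (Fin q × M) (Fin q × M) ℂ) =>
    (traceNorm_add_le (X + (-1 : ℂ) • Y + Complex.I • Z) ((-Complex.I) • W)).trans
      (add_le_add_left ((traceNorm_add_le (X + (-1 : ℂ) • Y) (Complex.I • Z)).trans
        (add_le_add_left (traceNorm_add_le X ((-1 : ℂ) • Y)) _)) _)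
  simp only [traceNorm_smul, norm_neg, Complex.norm_I, norm_one, one_mul] at t1
  have t2 := (t1 _ _ _ _).trans (add_le_add (add_le_add (add_le_add k1 k2) k3) k4)
  have e4 : ‖(4 : ℂ)⁻¹‖ = (4 : ℝ)⁻¹ := by simp
  rw [e4, inv_mul_le_iff₀ (by norm_num)]
  linarith

theorem cbNorm_le_of_isQuantumProof {k ε : ℝ} (hε : 0 ≤ ε) {f : D → N → M}
    (hkN : (2 : ℝ) ^ k ≤ Fintype.card N) (hf : IsQuantumProof (k - 1) ε f) :
    cbNorm (capCap N ((2 : ℝ) ^ k)) (ellOne M) (Delta f) ≤ ENNReal.ofReal (8 * ε) := by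
  refine iSup_le fun q => iSup_le fun x => iSup_le fun hx => iSup_le fun A => iSup_le fun B =>
    iSup_le fun hA => iSup_le fun hB => ENNReal.ofReal_le_ofReal ?_
  rw [← embed_sandwich, ← sandwich_map]
  refine le_of_forall_pos_le_add fun η hη => ?_
  have h8 : 0 < 8 * ε + 1 := by positivity
  have h := traceNorm_sandwich_map_le hε hf hkN hx hA hB
    -- Chosen so that `8 c ε ≤ 8 ε + η`, which amounts to letting `c` tend to `1`.
    (c := 1 + η / (8 * ε + 1)) (by linarith [div_pos hη h8])
  refine h.trans ?_
  have h2 : η / (8 * ε + 1) * (8 * ε + 1) = η := div_mul_cancel₀ _ h8.ne'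
  have h3 : 0 < η / (8 * ε + 1) := div_pos hη h8
  nlinarith

end Converse

end QuantumExtractor

end

theorem theorem2 (n m d : ℕ) (f : (Fin d → Bool) → (Fin n → Bool) → (Fin m → Bool))
    (k ε : ℝ) (hε : 0 ≤ ε) :
    (QuantumExtractor.cbNorm (QuantumExtractor.capCap (Fin n → Bool) ((2 : ℝ) ^ k))
          (QuantumExtractor.ellOne (Fin m → Bool)) (QuantumExtractor.Delta f) ≤ ENNReal.ofReal ε →
        QuantumExtractor.IsQuantumProof k (2 * ε) f) ∧
      (k ≤ n → QuantumExtractor.IsQuantumProof (k - 1) ε f →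
        QuantumExtractor.cbNorm (QuantumExtractor.capCap (Fin n → Bool) ((2 : ℝ) ^ k))
          (QuantumExtractor.ellOne (Fin m → Bool)) (QuantumExtractor.Delta f) ≤
            ENNReal.ofReal (8 * ε)) := by
  refine ⟨QuantumExtractor.isQuantumProof_of_cbNorm_le hε, fun hk hf =>
    QuantumExtractor.cbNorm_le_of_isQuantumProof hε ?_ hf⟩
  rw [Fintype.card_fun, Fintype.card_bool, Fintype.card_fin, Nat.cast_pow, Nat.cast_ofNat,
    ← Real.rpow_natCast]
  exact Real.rpow_le_rpow_of_exponent_le one_le_two hk
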